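/- Let $U$ be a universal prefix machine: a partial computable function $U(p,x)$ on pairs of binary strings such that for each $x$ the set of $p$ on which $U(\cdot,x)$ halts is prefix-free, and such that for every partial computable $T$ with the same property there is a constant $c_T$ for which $T(p,x)=y$ implies $U(p',x)=y$ for some $p'$ with $\ell(p')\le\ell(p)+c_T$. Write $K(n)=\min\{\ell(p):U(p,\epsilon)=\langle n\rangle\}$ for the prefix complexity of a natural number $n$, where $\langle n\rangle$ is its binary code. A semimeasure is a function $\nu:\{0,1\}^*\to[0,1]$ with $\nu(x0)+\nu(x1)\le\nu(x)$ for all $x$ and $\nu(\epsilon)\le1$; it is a measure if equality holds in both. A function $f:\{0,1\}^*\to\mathbb R$ is enumerable (co-enumerable) if the set of pairs $(x,q)$ with $q\in\mathbb Q$ and $f(x)>q$ (respectively $f(x)<q$) is recursively enumerable. A measure $\mu$ is computable if it is enumerable and co-enumerable and $\{x:\mu(x)=0\}$ is decidable, and positive if $\mu(x)>0$ for all $x$. Let $\nu_0,\nu_1,\dots$ be an effective enumeration of all enumerable semimeasures (that is, $\nu_i(x)$ is enumerable as a function of $(i,x)$), and let $M(x)=\sum_i 2^{-K(i)}\nu_i(x)$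 be the Solomonoff–Levin prior. Write $\rho(y\mid x)=\rho(xy)/\rho(x)$ and, for a string $x$ of length $l-1$, $$D_{l:n}(x)=\sum_{y\in\{0,1\}^{n-l+1}}\mu(y\mid x)\ln\frac{\mu(y\mid x)}{M(y\mid x)},\qquad D_{l:\infty}(x)=\lim_{n\to\infty}D_{l:n}(x).$$ Then for every positive computable measure $\mu$ there are a computable sequence $\alpha=\alpha_1\alpha_2\dots\in\{0,1\}^\infty$ and a constant $C$ such that for every $l\ge1$, with $\alpha_{<l}=\alpha_1\dots\alpha_{l-1}$, the (possibly infinite) limit $D_{l:\infty}(\alpha_{<l})$ exists and $$D_{l:\infty}(\alpha_{<l})\;\ge\;D_{l:l}(\alpha_{<l})\;=\;\sum_{b\in\{0,1\}}\mu(b\mid\alpha_{<l})\ln\frac{\mu(b\mid\alpha_{<l})}{M(b\mid\alpha_{<l})}\;\ge\;\tfrac13K(l)-C .$$ -/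

import Mathlib

/-- A property of a function `f` with nonnegative real values on constructive objects:
`f` is *enumerable* (lower semicomputable), i.e. the set of pairs `⟨x, k/n⟩` with `f x > k/n`
is recursively enumerable.  The denominator is written `n + 1` so that it is never zero;
negative rationals lie trivially below `f` and are not listed. -/
def AIT.Enumerable {α : Type} [Primcodable α] (f : α → ℝ) : Prop :=
  REPred fun q : α × ℕ × ℕ => (q.2.1 : ℝ) / ((q.2.2 : ℝ) + 1) < f q.1

/-- Co-enumerable (upper semicomputable): the set of pairs `⟨x, k/n⟩` with `f x < k/n` is
recursively enumerable. -/
def AIT.CoEnumerable {α : Type} [Primcodable α] (f : α → ℝ) : Prop :=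
  REPred fun q : α × ℕ × ℕ => f q.1 < (q.2.1 : ℝ) / ((q.2.2 : ℝ) + 1)

/-- Semimeasures on binary strings. -/
structure AIT.IsSemimeasure (ρ : List Bool → ℝ) : Prop where
  nonneg : ∀ x, 0 ≤ ρ x
  nil_le : ρ [] ≤ 1
  add_le : ∀ x, ρ (x ++ [false]) + ρ (x ++ [true]) ≤ ρ x

/-- Measures (proper probability measures on binary sequences, given on cylinders). -/
structure AIT.IsMeasure (ρ : List Bool → ℝ) : Prop where
  nonneg : ∀ x, 0 ≤ ρ x
  nil_eq : ρ [] = 1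
  add_eq : ∀ x, ρ (x ++ [false]) + ρ (x ++ [true]) = ρ x

/-- Computable measures: enumerable, co-enumerable, with a decidable set of null strings. -/
structure AIT.IsComputableMeasure (μ : List Bool → ℝ) : Prop where
  isMeasure : AIT.IsMeasure μ
  enumerable : AIT.Enumerable μ
  coEnumerable : AIT.CoEnumerable μ
  decidable_zero : ComputablePred fun x => μ x = 0

/-- A prefix (self-delimiting) machine `T`, with program `p` and input `x`: a partial computable
function such that for every input `x` the set of halting programs is prefix-free. -/
structure AIT.IsPrefixMachine (T : List Bool → List Bool →. List Bool) : Prop where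
  partrec : Partrec₂ T
  prefixFree : ∀ x p q, (T p x).Dom → (T q x).Dom → p <+: q → p = q

/-- A universal prefix machine: a prefix machine that simulates every prefix machine with programs
that are longer by at most a constant. -/
structure AIT.IsUniversalPrefixMachine (U : List Bool → List Bool →. List Bool) : Prop where
  isPrefixMachine : AIT.IsPrefixMachine U
  universal : ∀ T, AIT.IsPrefixMachine T →
    ∃ c : ℕ, ∀ p x y, y ∈ T p x → ∃ p', p'.length ≤ p.length + c ∧ y ∈ U p' x

/-- Conditional prefix complexity `K(y | x) = min {ℓ(p) : U(p, x) = y}`. -/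
noncomputable def AIT.condK (U : List Bool → List Bool →. List Bool) (y x : List Bool) : ℕ :=
  sInf {k | ∃ p : List Bool, p.length = k ∧ y ∈ U p x}

/-- Prefix complexity `K(n) = K(⟨n⟩ | ε)` of a natural number `n`, coded by its binary digits. -/
noncomputable def AIT.K (U : List Bool → List Bool →. List Bool) (n : ℕ) : ℕ :=
  AIT.condK U (Nat.bits n) []

/-- `ν 0, ν 1, …` is an effective enumeration of all enumerable semimeasures. -/
structure AIT.IsEnumerationOfSemimeasures (ν : ℕ → List Bool → ℝ) : Prop where
  isSemimeasure : ∀ i, AIT.IsSemimeasure (ν i)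
  enumerable : AIT.Enumerable fun q : ℕ × List Bool => ν q.1 q.2
  exhaustive : ∀ ρ, AIT.IsSemimeasure ρ → AIT.Enumerable ρ → ∃ i, ν i = ρ

/-- Solomonoff–Levin prior `M(x) = ∑_i 2^{-K(ν_i)} ν_i(x)`, where `K(ν_i) = K(i)`. -/
noncomputable def AIT.M (U : List Bool → List Bool →. List Bool) (ν : ℕ → List Bool → ℝ)
    (x : List Bool) : ℝ :=
  ∑' i, (2 : ℝ)⁻¹ ^ AIT.K U i * ν i x

/-- Conditional probability `ρ(y | x) = ρ(xy) / ρ(x)`, used only where `ρ(x) > 0`. -/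
noncomputable def AIT.cond (ρ : List Bool → ℝ) (y x : List Bool) : ℝ :=
  ρ (x ++ y) / ρ x

/-- `D_{l:n}(x) = E[ln (μ(ω_{l:n} | x) / ρ(ω_{l:n} | x)) | x]` for a string `x` of length `l - 1`;
the expectation is the `μ(· | x)`-average over the strings `ω_{l:n}` of length `n + 1 - l`. -/
noncomputable def AIT.D (μ ρ : List Bool → ℝ) (l n : ℕ) (x : List Bool) : ℝ :=
  ∑ y : Fin (n + 1 - l) → Bool,
    AIT.cond μ (List.ofFn y) x *
      Real.log (AIT.cond μ (List.ofFn y) x / AIT.cond ρ (List.ofFn y) x)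

/-- `D_{l:∞}(x) = lim_{n → ∞} D_{l:n}(x)`, a limit in the extended reals. -/
noncomputable def AIT.DInf (μ ρ : List Bool → ℝ) (l : ℕ) (x : List Bool) : EReal :=
  Filter.limUnder Filter.atTop fun n => ((AIT.D μ ρ l n x : ℝ) : EReal)

/-- `α_{<l} = α_1 … α_{l-1}` for a sequence `α = α_1 α_2 …`, where `α_t` is stored as
`α (t - 1)`. -/
def AIT.before (α : ℕ → Bool) (l : ℕ) : List Bool :=
  (List.range (l - 1)).map α

/-! Let α always take a bit whose opposite has conditional μ-probability above 49/100
(`IsComputableMeasure.exists_computable_bit`). One bit has probability at least 1/2, so a search for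
a rational certificate of the strict inequality terminates; an exact comparison with 1/2 would not
be decidable.

The point mass on α is an enumerable semimeasure, so M(α_{<l}) stays above some c₁ > 0. The strings
α_{<l}b, with b the bit that α avoids, are pairwise incomparable, so their M-masses sum to at most 1
(`IsSemimeasure.sum_selfPrefix_le_one`). As M is enumerable (`re_two_inv_pow_lt_M`), the times l at
which this mass exceeds 2^(-100m) can be listed, and there are at most 2^(100m) of them. Such an l
has a program 1^m 0 w, where w is its index in the list, written with 100m bits
(`IsUniversalPrefixMachine.exists_program`). Hence -log₂ M(α_{<l}b) ≥ (100/101) K(l) - O(1), and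
dividing by M(α_{<l}) ≥ c₁ gives the same for M(b | α_{<l}).

In D_{l:l} the factor -ln M(b | α_{<l}) has weight above 49/100 and everything else contributes at
least -1. The resulting coefficient (49/100)(100/101) ln 2 of K(l) exceeds 1/3. By the log sum
inequality (`log_sum_le`), D_{l:n} is nondecreasing in n, so its limit exists in the extended reals
and dominates D_{l:l}. -/

/-! ### Closure properties of r.e. predicates and effective choice -/

section RecursivelyEnumerable

variable {α β : Type*} [Primcodable α] [Primcodable β]

/-- Kleene normal form: a recursively enumerable predicate is the union of an increasing sequence
of primitive recursive predicates. -/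
theorem REPred.exists_primrecRel {p : α → Prop} (hp : REPred p) :
    ∃ R : α → ℕ → Prop, PrimrecRel R ∧ (∀ a k k', k ≤ k' → R a k → R a k') ∧
      ∀ a, p a ↔ ∃ k, R a k := by
  obtain ⟨c, hc⟩ := Nat.Partrec.Code.exists_code.1 hp
  refine ⟨fun a k => (Nat.Partrec.Code.evaln k c (Encodable.encode a)).isSome = true, ?_, ?_, ?_⟩
  · refine Primrec.eq.comp (Primrec.option_isSome.comp ?_) (Primrec.const true)
    exact Nat.Partrec.Code.primrec_evaln.comp
      ((Primrec.snd.pair (Primrec.const c)).pair (Primrec.encode.comp Primrec.fst))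
  · intro a k k' hk h
    obtain ⟨x, hx⟩ := Option.isSome_iff_exists.1 h
    exact Option.isSome_iff_exists.2 ⟨x, Nat.Partrec.Code.evaln_mono hk hx⟩
  · intro a
    have h1 : p a ↔ (Nat.Partrec.Code.eval c (Encodable.encode a)).Dom := by
      rw [hc]; simp [Part.assert]
    rw [h1, Part.dom_iff_mem]
    simp only [Nat.Partrec.Code.evaln_complete, Option.isSome_iff_exists]
    exact exists_comm

theorem REPred.comp {p : β → Prop} {f : α → β} (hp : REPred p) (hf : Computable f) :
    REPred fun a => p (f a) :=
  Partrec.comp hp hf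

theorem REPred.and {p q : α → Prop} (hp : REPred p) (hq : REPred q) :
    REPred fun a => p a ∧ q a :=
  (Partrec.dom_re (Partrec.bind hp (Partrec.comp hq Computable.fst).to₂)).of_eq fun a => by
    simp [Part.assert, Part.bind]

theorem PrimrecRel.exists_re {R : α → ℕ → Prop} (hR : PrimrecRel R) :
    REPred fun a => ∃ k, R a k := by
  classical
  have h : Partrec fun a => Nat.rfind fun k => Part.some (decide (R a k)) :=
    Partrec.rfind hR.computablePred.decide.partrec
  exact h.dom_re.of_eq fun a => Nat.rfind_dom.trans
    ⟨fun ⟨k, hk, _⟩ => ⟨k, by simpa using Part.mem_some_iff.1 hk⟩,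
      fun ⟨k, hk⟩ => ⟨k, Part.mem_some_iff.2 (by simpa using hk), fun _ => trivial⟩⟩

/-- A search procedure for witnesses of a recursively enumerable relation. -/
theorem REPred.exists_search {p : α × β → Prop} (hp : REPred p) :
    ∃ Q : α → ℕ → Prop, PrimrecRel Q ∧
      (∀ a n, Q a n → ∃ b, Encodable.decode n.unpair.1 = some b ∧ p (a, b)) ∧
      ∀ a b, p (a, b) → ∃ n, Q a n := by
  classical
  obtain ⟨R, hR, -, hpR⟩ := hp.exists_primrecRel
  -- The number `n` codes a candidate witness together with a time bound.
  refine ⟨fun a n => ∃ b, Encodable.decode (α := β) n.unpair.1 = some b ∧ R (a, b) n.unpair.2,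
    ?_, ?_, ?_⟩
  · have h : Primrec fun x : α × ℕ =>
        ((Encodable.decode (α := β) x.2.unpair.1).map
          fun b => decide (R (x.1, b) x.2.unpair.2)).getD false := by
      refine Primrec.option_getD.comp (Primrec.option_map (Primrec.decode.comp
        (Primrec.fst.comp (Primrec.unpair.comp Primrec.snd))) ?_) (Primrec.const false)
      exact hR.decide.comp ((Primrec.fst.comp Primrec.fst).pair Primrec.snd)
        (Primrec.snd.comp (Primrec.unpair.comp (Primrec.snd.comp Primrec.fst)))
    refine PrimrecPred.of_eq (Primrec.eq.comp h (Primrec.const true)) fun x => ?_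
    cases hd : (Encodable.decode (α := β) x.2.unpair.1) <;> simp [hd]
  · rintro a n ⟨b, hb, h⟩
    exact ⟨b, hb, (hpR _).2 ⟨_, h⟩⟩
  · intro a b h
    obtain ⟨k, hk⟩ := (hpR _).1 h
    exact ⟨Nat.pair (Encodable.encode b) k, b, by simpa using hk⟩

theorem REPred.exists {p : α × β → Prop} (hp : REPred p) : REPred fun a => ∃ b, p (a, b) := by
  obtain ⟨Q, hQ, h1, h2⟩ := hp.exists_search
  refine hQ.exists_re.of_eq fun a => ⟨fun ⟨n, hn⟩ => ?_, fun ⟨b, hb⟩ => h2 a b hb⟩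
  obtain ⟨b, -, hb⟩ := h1 a n hn
  exact ⟨b, hb⟩

theorem REPred.exists_computable_choice [Inhabited β] {p : α × β → Prop} (hp : REPred p)
    (h : ∀ a, ∃ b, p (a, b)) : ∃ f : α → β, Computable f ∧ ∀ a, p (a, f a) := by
  classical
  obtain ⟨Q, hQ, h1, h2⟩ := hp.exists_search
  have hex : ∀ a, ∃ n, Q a n := fun a => let ⟨b, hb⟩ := h a; h2 a b hb
  refine ⟨fun a => (Encodable.decode (α := β) (Nat.find (hex a)).unpair.1).getD default, ?_, ?_⟩
  · exact Computable.option_getD (Computable.decode.comp (Computable.fst.comp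
      (Computable.unpair.comp (Computable.find hQ.computablePred hex)))) (Computable.const default)
  · intro a
    obtain ⟨b, hb, hp⟩ := h1 a _ (Nat.find_spec (hex a))
    simpa [hb] using hp

end RecursivelyEnumerable

/-! ### Short programs for the members of small r.e. sets -/

section Coding

/-- The number with binary digits `w`, least significant digit first. -/
def List.bitValue (w : List Bool) : ℕ :=
  w.foldr (fun b n => 2 * n + b.toNat) 0

theorem List.exists_bitValue_eq (k j : ℕ) (hj : j < 2 ^ k) :
    ∃ w : List Bool, w.length = k ∧ w.bitValue = j := by
  induction k generalizing j with
  | zero => exact ⟨[], rfl, by simp at hj; simp [List.bitValue, hj]⟩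
  | succ k ih =>
    obtain ⟨w, hw, hv⟩ := ih (j / 2) (by omega)
    refine ⟨j.bodd :: w, by simp [hw], ?_⟩
    have h := Nat.bodd_add_div2 j
    have e : List.bitValue (j.bodd :: w) = 2 * w.bitValue + j.bodd.toNat := rfl
    rw [e, hv, ← Nat.div2_val]
    cases hb : j.bodd <;> simp [hb] at h ⊢ <;> omega

theorem List.primrec_bitValue : Primrec List.bitValue := by
  refine Primrec.list_foldr Primrec.id (Primrec.const 0) 
    (h := fun _ (x : Bool × ℕ) => 2 * x.2 + x.1.toNat) ?_
  exact Primrec.nat_add.comp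
    (Primrec.nat_mul.comp (Primrec.const 2) (Primrec.snd.comp Primrec.snd))
    ((Primrec.dom_bool Bool.toNat).comp (Primrec.fst.comp Primrec.snd))

/-- The successor operation on binary expansions, least significant digit first. -/
def List.bitSucc (w : List Bool) : List Bool :=
  List.recOn w [true] fun b tl ih => bif b then false :: ih else true :: tl

theorem List.primrec_bitSucc : Primrec List.bitSucc := by
  refine Primrec.list_rec Primrec.id (Primrec.const [true])
    (h := fun _ x => bif x.1 then false :: x.2.2 else true :: x.2.1) ?_
  have h := Primrec.snd (α := List Bool) (β := Bool × List Bool × List Bool)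
  exact Primrec.cond (Primrec.fst.comp h)
    (Primrec.list_cons.comp (Primrec.const false) (Primrec.snd.comp (Primrec.snd.comp h)))
    (Primrec.list_cons.comp (Primrec.const true) (Primrec.fst.comp (Primrec.snd.comp h)))

theorem Nat.bitSucc_bits (n : ℕ) : (Nat.bits n).bitSucc = Nat.bits (n + 1) := by
  induction n using Nat.binaryRec' with
  | zero => simp [List.bitSucc]
  | bit b n h ih =>
    rw [Nat.bits_append_bit _ _ h]
    cases b with
    | false =>
      have e : Nat.bit false n + 1 = Nat.bit true n := by simp [Nat.bit_val]
      rw [e, Nat.bits_append_bit _ _ (by simp)]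
      rfl
    | true =>
      have e : Nat.bit true n + 1 = Nat.bit false (n + 1) := by simp [Nat.bit_val]; ring
      rw [e, Nat.bits_append_bit _ _ (by simp), ← ih]
      rfl

theorem Nat.primrec_bits : Primrec Nat.bits := by
  refine (Primrec.nat_rec₁ (f := fun _ w => List.bitSucc w) []
    (List.primrec_bitSucc.comp Primrec.snd)).of_eq fun n => ?_
  induction n with
  | zero => simp
  | succ n ih => rw [← Nat.bitSucc_bits, ← ih]

/-- The event that a second component is first listed at stage `n`, where `n` codes a pair of a
time and an element. -/
def IsFirstAt (R : ℕ → ℕ → Prop) (n : ℕ) : Prop :=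
  R n.unpair.2 n.unpair.1 ∧ (n.unpair.1 = 0 ∨ ¬ R n.unpair.2 (n.unpair.1 - 1))

/-- Monotonicity in time leaves each element only one first stage, so counting stages counts
elements. -/
theorem IsFirstAt.injOn {R : ℕ → ℕ → Prop} (hmono : ∀ a k k', k ≤ k' → R a k → R a k')
    {n n' : ℕ} (hn : IsFirstAt R n) (hn' : IsFirstAt R n') (h : n.unpair.2 = n'.unpair.2) :
    n = n' := by
  have key : ∀ {n n' : ℕ}, IsFirstAt R n → IsFirstAt R n' → n.unpair.2 = n'.unpair.2 →
      ¬ n.unpair.1 < n'.unpair.1 := by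
    intro n n' hn hn' h hlt
    rcases hn'.2 with h0 | h0
    · omega
    · exact h0 (h ▸ hmono _ _ _ (by omega) hn.1)
  have h1 : n.unpair.1 = n'.unpair.1 := by
    have := key hn hn' h
    have := key hn' hn h.symm
    omega
  rw [← Nat.pair_unpair n, ← Nat.pair_unpair n', h, h1]

theorem exists_isFirstAt {R : ℕ → ℕ → Prop} {l : ℕ} (h : ∃ k, R l k) :
    ∃ n, IsFirstAt R n ∧ n.unpair.2 = l := by
  classical
  refine ⟨Nat.pair (Nat.find h) l, ⟨by simpa using Nat.find_spec h, ?_⟩, by simp⟩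
  rcases Nat.eq_zero_or_pos (Nat.find h) with h0 | h0
  · left; simpa using h0
  · right
    simpa using Nat.find_min h (Nat.sub_lt h0 one_pos)

theorem primrec_count {P : ℕ → ℕ → Prop} [DecidableRel P] (hP : PrimrecRel P) :
    Primrec₂ fun m n => Nat.count (P m) n := by
  have h : Primrec₂ fun (m n : ℕ) =>
      Nat.rec (motive := fun _ => ℕ) 0 (fun k c => c + if P m k then 1 else 0) n := by
    refine Primrec.nat_rec (f := fun _ => 0)
      (g := fun m (x : ℕ × ℕ) => x.2 + if P m x.1 then 1 else 0) (Primrec.const 0) ?_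
    refine Primrec.nat_add.comp (Primrec.snd.comp Primrec.snd)
      (Primrec.ite (hP.comp Primrec.fst (Primrec.fst.comp Primrec.snd))
        (Primrec.const 1) (Primrec.const 0))
  refine h.of_eq fun m n => ?_
  induction n with
  | zero => simp
  | succ n ih => rw [Nat.count_succ, ← ih]

/-- The length of the unary prefix of a program. -/
def unaryPrefix (p : List Bool) : ℕ := p.findIdx (!·)

theorem primrec_unaryPrefix : Primrec unaryPrefix :=
  Primrec.list_findIdx Primrec.id (Primrec.not.comp Primrec.snd)

theorem unaryPrefix_replicate_append (m : ℕ) (w : List Bool) :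
    unaryPrefix (List.replicate m true ++ false :: w) = m := by
  induction m with
  | zero => simp [unaryPrefix, List.findIdx_cons]
  | succ m ih => simp_all [unaryPrefix, List.replicate_succ, List.findIdx_cons]

theorem unaryPrefix_eq_of_prefix {p q : List Bool} (h : p <+: q)
    (hp : unaryPrefix p < p.length) : unaryPrefix p = unaryPrefix q := by
  obtain ⟨r, rfl⟩ := h
  simp only [unaryPrefix] at hp ⊢
  rw [List.findIdx_append, if_pos hp]

/-- If the sections `S m` of a recursively enumerable relation have at most `2 ^ (B * m)` elements,
then the members of `S m` have prefix complexity at most `(B + 1) * m + O(1)`. -/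
theorem AIT.IsUniversalPrefixMachine.exists_program {U : List Bool → List Bool →. List Bool}
    (hU : AIT.IsUniversalPrefixMachine U) (B : ℕ) {S : ℕ × ℕ → Prop} (hS : REPred S)
    (hcard : ∀ m (F : Finset ℕ), (∀ l ∈ F, S (m, l)) → F.card ≤ 2 ^ (B * m)) :
    ∃ c : ℕ, ∀ m l, S (m, l) →
      ∃ p : List Bool, p.length ≤ (B + 1) * m + c ∧ Nat.bits l ∈ U p [] := by
  classical
  obtain ⟨R, hR, hmono, hSR⟩ := hS.exists_primrecRel
  let E : ℕ → ℕ → Prop := fun m n => IsFirstAt (fun l k => R (m, l) k) n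
  have hE : PrimrecRel E := by
    have u2 : Primrec fun x : ℕ × ℕ => x.2.unpair.2 :=
      Primrec.snd.comp (Primrec.unpair.comp Primrec.snd)
    have u1 : Primrec fun x : ℕ × ℕ => x.2.unpair.1 :=
      Primrec.fst.comp (Primrec.unpair.comp Primrec.snd)
    refine PrimrecPred.and (hR.comp (Primrec.fst.pair u2) u1) (PrimrecPred.or ?_ ?_)
    · exact Primrec.eq.comp u1 (Primrec.const 0)
    · exact (hR.comp (Primrec.fst.pair u2) (Primrec.nat_sub.comp u1 (Primrec.const 1))).not
  -- A program is 1^m 0 w with w of length `B * m`; `w` is the number of elements of `S m` listed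
  -- before the output.
  let Q : List Bool → ℕ → Prop := fun p n =>
    p.length = (B + 1) * unaryPrefix p + 1 ∧ E (unaryPrefix p) n ∧
      Nat.count (E (unaryPrefix p)) n = (p.drop (unaryPrefix p + 1)).bitValue
  have hQ : PrimrecRel Q := by
    have hm : Primrec fun x : List Bool × ℕ => unaryPrefix x.1 :=
      primrec_unaryPrefix.comp Primrec.fst
    refine PrimrecPred.and ?_ (PrimrecPred.and (hE.comp hm Primrec.snd) ?_)
    · exact Primrec.eq.comp (Primrec.list_length.comp Primrec.fst)
        (Primrec.succ.comp (Primrec.nat_mul.comp (Primrec.const (B + 1)) hm))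
    · exact Primrec.eq.comp ((primrec_count hE).comp hm Primrec.snd)
        (List.primrec_bitValue.comp (Primrec.list_drop.comp (Primrec.succ.comp hm) Primrec.fst))
  let T : List Bool → List Bool →. List Bool := fun p _ =>
    (Nat.rfind fun n => Part.some (decide (Q p n))).map fun n => Nat.bits n.unpair.2
  have hTdom : ∀ p x, (T p x).Dom → ∃ n, Q p n := by
    intro p x h
    obtain ⟨n, hn, -⟩ := Nat.rfind_dom.1 h
    exact ⟨n, by simpa using Part.mem_some_iff.1 hn⟩
  have hT : AIT.IsPrefixMachine T := by
    constructor
    · refine Partrec.map (f := fun x : List Bool × List Bool =>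
          Nat.rfind fun n => Part.some (decide (Q x.1 n)))
        (g := fun _ n => Nat.bits n.unpair.2) ?_ ?_
      · exact Partrec.rfind
          (hQ.comp (Primrec.fst.comp Primrec.fst) Primrec.snd).computablePred.decide.partrec
      · exact (Nat.primrec_bits.comp
          (Primrec.snd.comp (Primrec.unpair.comp Primrec.snd))).to_comp
    · intro x p q hp hq hpq
      obtain ⟨n, hn, -⟩ := hTdom p x hp
      obtain ⟨n', hn', -⟩ := hTdom q x hq
      -- The unary part determines the length of a halting program, which makes the domain
      -- prefix-free. The length condition also forces the terminating `false` to be present.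
      have h := unaryPrefix_eq_of_prefix hpq (by
        rw [hn]; nlinarith [Nat.zero_le (B * unaryPrefix p)])
      exact hpq.eq_of_length (by rw [hn, hn', h])
  obtain ⟨c, hc⟩ := hU.universal T hT
  refine ⟨c + 1, fun m l hml => ?_⟩
  obtain ⟨n, hn, rfl⟩ := exists_isFirstAt (R := fun l k => R (m, l) k) ((hSR _).1 hml)
  have hcount : Nat.count (E m) n < 2 ^ (B * m) := by
    have h1 : Nat.count (E m) n < Nat.count (E m) (n + 1) := by
      rw [Nat.count_succ, if_pos (show E m n from hn)]; omega
    refine h1.trans_le ?_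
    rw [Nat.count_eq_card_filter_range, ← Finset.card_image_of_injOn (f := fun n => n.unpair.2)]
    · refine hcard m _ fun l hl => ?_
      obtain ⟨k, hk, rfl⟩ := Finset.mem_image.1 hl
      exact (hSR _).2 ⟨_, (Finset.mem_filter.1 hk).2.1⟩
    · intro a ha b hb hab
      exact IsFirstAt.injOn (fun a => hmono (m, a)) (Finset.mem_filter.1 ha).2
        (Finset.mem_filter.1 hb).2 hab
  obtain ⟨w, hw, hv⟩ := List.exists_bitValue_eq _ _ hcount
  set p := List.replicate m true ++ false :: w with hp
  have hup : unaryPrefix p = m := unaryPrefix_replicate_append m w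
  have hlen : p.length = (B + 1) * m + 1 := by simp [hp, hw]; ring
  have hdrop : p.drop (m + 1) = w := by
    simp [hp, List.drop_append]
  have hQp : Q p n := ⟨by rw [hup, hlen], by rw [hup]; exact hn, by rw [hup, hdrop, hv]⟩
  have hmem : Nat.bits n.unpair.2 ∈ T p [] := by
    refine (Part.mem_map_iff _).2 ⟨n, Nat.mem_rfind.2 ⟨?_, fun {k} hk => ?_⟩, rfl⟩
    · exact Part.mem_some_iff.2 (by simpa using hQp)
    · refine Part.mem_some_iff.2 (decide_eq_false fun hk' => ?_).symm
      obtain ⟨-, h1, h2⟩ := hk'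
      rw [hup] at h1 h2
      have h3 := hQp.2.2
      rw [hup, ← h2] at h3
      have := Nat.count_strict_mono h1 hk
      omega
  obtain ⟨p', hp', hmem'⟩ := hc p [] _ hmem
  exact ⟨p', by omega, hmem'⟩

end Coding

/-! ### The Kraft inequality, via McMillan -/

section Kraft

/-- The first codewords of two equal concatenations are prefixes of one string, hence comparable,
hence equal; cancel them and repeat. -/
theorem uniquelyDecodable_of_prefixFree {S : Set (List Bool)}
    (h : ∀ p ∈ S, ∀ q ∈ S, p <+: q → p = q) (hnil : [] ∉ S) :
    InformationTheory.UniquelyDecodable S := by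
  intro L₁
  induction L₁ with
  | nil =>
    intro L₂ _ h₂ e
    cases L₂ with
    | nil => rfl
    | cons v L₂ =>
      simp only [List.flatten_nil, List.flatten_cons] at e
      have : v = [] := by simpa using (List.append_eq_nil_iff.1 e.symm).1
      exact absurd (this ▸ h₂ v (by simp)) hnil
  | cons w L₁ ih =>
    intro L₂ h₁ h₂ e
    cases L₂ with
    | nil =>
      simp only [List.flatten_nil, List.flatten_cons] at e
      have : w = [] := by simpa using (List.append_eq_nil_iff.1 e).1
      exact absurd (this ▸ h₁ w (by simp)) hnil
    | cons v L₂ =>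
      simp only [List.flatten_cons] at e
      have hw := h₁ w (by simp)
      have hv := h₂ v (by simp)
      have hwv : w = v := by
        rcases List.prefix_or_prefix_of_prefix (List.prefix_append w L₁.flatten)
          (e ▸ List.prefix_append v L₂.flatten) with hp | hp
        · exact h w hw v hv hp
        · exact (h v hv w hw hp).symm
      subst hwv
      rw [ih L₂ (fun x hx => h₁ x (by simp [hx])) (fun x hx => h₂ x (by simp [hx]))
        (List.append_cancel_left e)]

/-- The Kraft inequality for finite prefix-free sets of binary strings. -/
theorem sum_two_inv_pow_length_le_one {S : Finset (List Bool)}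
    (h : ∀ p ∈ S, ∀ q ∈ S, p <+: q → p = q) : ∑ p ∈ S, (2 : ℝ)⁻¹ ^ p.length ≤ 1 := by
  -- A prefix-free set containing the empty word is a singleton; it is not uniquely decodable, so it
  -- is treated apart.
  by_cases hnil : [] ∈ S
  · have : S = {[]} := by
      ext q
      rw [Finset.mem_singleton]
      exact ⟨fun hq => (h _ hnil q hq (List.nil_prefix)).symm, fun hq => hq ▸ hnil⟩
    simp [this]
  · have := InformationTheory.kraft_mcmillan_inequality (S := S)
      (uniquelyDecodable_of_prefixFree (S := (S : Set (List Bool))) (by simpa using h)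
        (by simpa using hnil))
    simpa using this

end Kraft

namespace AIT

/-! ### Elementary bounds for semimeasures -/

section Semimeasure

variable {ρ : List Bool → ℝ}

theorem IsMeasure.isSemimeasure (h : IsMeasure ρ) : IsSemimeasure ρ :=
  ⟨h.nonneg, h.nil_eq.le, fun x => (h.add_eq x).le⟩

theorem IsSemimeasure.append_le (h : IsSemimeasure ρ) (x : List Bool) (b : Bool) :
    ρ (x ++ [b]) ≤ ρ x := by
  have := h.add_le x
  have := h.nonneg (x ++ [false])
  have := h.nonneg (x ++ [true])
  cases b <;> linarith

theorem IsSemimeasure.add_not_le (h : IsSemimeasure ρ) (x : List Bool) (b : Bool) :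
    ρ (x ++ [b]) + ρ (x ++ [!b]) ≤ ρ x := by
  have := h.add_le x
  cases b <;> simp only [Bool.not_false, Bool.not_true] <;> linarith

theorem IsMeasure.add_not_eq (h : IsMeasure ρ) (x : List Bool) (b : Bool) :
    ρ (x ++ [b]) + ρ (x ++ [!b]) = ρ x := by
  have := h.add_eq x
  cases b <;> simp only [Bool.not_false, Bool.not_true] <;> linarith

theorem IsSemimeasure.le_one (h : IsSemimeasure ρ) (x : List Bool) : ρ x ≤ 1 := by
  induction x using List.reverseRecOn with
  | nil => exact h.nil_le
  | append_singleton x b ih => exact (h.append_le x b).trans ih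

end Semimeasure

/-! ### Prefix complexity and the weights 2^(-K(i)) -/

section Complexity

variable {U : List Bool → List Bool →. List Bool}

/-- Ensures that the infimum defining `K` is attained, and is not the default value 0 of `sInf ∅`.
-/
theorem IsUniversalPrefixMachine.exists_program_bits (hU : IsUniversalPrefixMachine U) (n : ℕ) :
    ∃ p : List Bool, Nat.bits n ∈ U p [] := by
  have hS : REPred fun x : ℕ × ℕ => x.2 = x.1 :=
    (Primrec.eq.comp Primrec.snd Primrec.fst).computablePred.to_re
  obtain ⟨c, hc⟩ := hU.exists_program 1 hS (fun m F hF => by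
    have : F ⊆ {m} := fun l hl => Finset.mem_singleton.2 (hF l hl)
    exact (Finset.card_le_card this).trans (by simpa using Nat.one_le_two_pow))
  obtain ⟨p, -, hp⟩ := hc n n rfl
  exact ⟨p, hp⟩

theorem IsUniversalPrefixMachine.exists_program_length_eq (hU : IsUniversalPrefixMachine U)
    (n : ℕ) : ∃ p : List Bool, p.length = K U n ∧ Nat.bits n ∈ U p [] := by
  obtain ⟨p, hp⟩ := hU.exists_program_bits n
  exact Nat.sInf_mem (s := {k | ∃ p : List Bool, p.length = k ∧ Nat.bits n ∈ U p []})
    ⟨_, p, rfl, hp⟩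

theorem K_le_length {n : ℕ} {p : List Bool} (hp : Nat.bits n ∈ U p []) : K U n ≤ p.length :=
  Nat.sInf_le ⟨p, rfl, hp⟩

theorem _root_.Nat.bits_injective : Function.Injective Nat.bits := by
  intro m n h
  induction m using Nat.binaryRec' generalizing n with
  | zero =>
    induction n using Nat.binaryRec' with
    | zero => rfl
    | bit b n hb _ => rw [Nat.bits_append_bit _ _ hb] at h; simp at h
  | bit b m hb ih =>
    induction n using Nat.binaryRec' with
    | zero => rw [Nat.bits_append_bit _ _ hb] at h; simp at h
    | bit b' n hb' _ =>
      rw [Nat.bits_append_bit _ _ hb, Nat.bits_append_bit _ _ hb'] at h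
      obtain ⟨hbb, hmn⟩ := List.cons.inj h
      rw [hbb, ih hmn]

/-- Shortest programs of distinct numbers are distinct and form a prefix-free set, so Kraft applies.
-/
theorem IsUniversalPrefixMachine.sum_two_inv_pow_K_le_one (hU : IsUniversalPrefixMachine U)
    (F : Finset ℕ) : ∑ i ∈ F, (2 : ℝ)⁻¹ ^ K U i ≤ 1 := by
  choose p hp hpU using hU.exists_program_length_eq
  have hinj : Function.Injective p := fun i j hij =>
    Nat.bits_injective (Part.mem_unique (hpU i) (hij ▸ hpU j))
  have h := sum_two_inv_pow_length_le_one (S := F.image p) (by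
    intro a ha b hb hab
    obtain ⟨i, -, rfl⟩ := Finset.mem_image.1 ha
    obtain ⟨j, -, rfl⟩ := Finset.mem_image.1 hb
    exact hU.isPrefixMachine.prefixFree [] _ _ (Part.dom_iff_mem.2 ⟨_, hpU i⟩)
      (Part.dom_iff_mem.2 ⟨_, hpU j⟩) hab)
  rw [Finset.sum_image hinj.injOn] at h
  simpa only [hp] using h

theorem IsUniversalPrefixMachine.summable_two_inv_pow_K (hU : IsUniversalPrefixMachine U) :
    Summable fun i => (2 : ℝ)⁻¹ ^ K U i :=
  summable_of_sum_le (fun _ => by positivity) hU.sum_two_inv_pow_K_le_one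

end Complexity

/-! ### M is a semimeasure and dominates all enumerable ones -/

section Prior

variable {U : List Bool → List Bool →. List Bool} {ν : ℕ → List Bool → ℝ}

theorem summable_M (hU : IsUniversalPrefixMachine U) (hν : ∀ i, IsSemimeasure (ν i))
    (x : List Bool) : Summable fun i => (2 : ℝ)⁻¹ ^ K U i * ν i x :=
  Summable.of_nonneg_of_le (fun i => mul_nonneg (by positivity) ((hν i).nonneg x))
    (fun i => mul_le_of_le_one_right (by positivity) ((hν i).le_one x)) hU.summable_two_inv_pow_K

theorem isSemimeasure_M (hU : IsUniversalPrefixMachine U) (hν : ∀ i, IsSemimeasure (ν i)) :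
    IsSemimeasure (M U ν) where
  nonneg x := tsum_nonneg fun i => mul_nonneg (by positivity) ((hν i).nonneg x)
  nil_le := by
    refine Real.tsum_le_of_sum_le (fun i => mul_nonneg (by positivity) ((hν i).nonneg _)) fun F => ?_
    refine (Finset.sum_le_sum fun i _ => ?_).trans (hU.sum_two_inv_pow_K_le_one F)
    exact mul_le_of_le_one_right (by positivity) ((hν i).le_one _)
  add_le x := by
    rw [M, M, ← (summable_M hU hν _).tsum_add (summable_M hU hν _)]
    refine Summable.tsum_le_tsum (fun i => ?_)
      ((summable_M hU hν _).add (summable_M hU hν _)) (summable_M hU hν _)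
    rw [← mul_add]
    exact mul_le_mul_of_nonneg_left ((hν i).add_le x) (by positivity)

/-- The prior `M` dominates every semimeasure in the enumeration. -/
theorem exists_pos_mul_le_M (hU : IsUniversalPrefixMachine U)
    (hν : IsEnumerationOfSemimeasures ν) {ρ : List Bool → ℝ} (hρ : IsSemimeasure ρ)
    (hρe : Enumerable ρ) : ∃ c : ℝ, 0 < c ∧ ∀ x, c * ρ x ≤ M U ν x := by
  obtain ⟨i, rfl⟩ := hν.exhaustive ρ hρ hρe
  exact ⟨_, by positivity, fun x => (summable_M hU hν.isSemimeasure x).le_tsum i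
    fun j _ => mul_nonneg (by positivity) ((hν.isSemimeasure j).nonneg x)⟩

end Prior

end AIT

namespace AIT

/-! ### Enumerability of M through finite certificates -/

section Enumerability

theorem _root_.Primrec.nat_pow : Primrec₂ ((· ^ ·) : ℕ → ℕ → ℕ) :=
  Primrec₂.unpaired'.1 Nat.Primrec.pow

theorem _root_.Primrec.sum_range {α : Type*} [Primcodable α] {f : α → ℕ → ℕ} (hf : Primrec₂ f) :
    Primrec₂ fun a n => ∑ i ∈ Finset.range n, f a i := by
  have h : Primrec₂ fun (a : α) (n : ℕ) =>
      Nat.rec (motive := fun _ => ℕ) 0 (fun k c => c + f a k) n :=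
    Primrec.nat_rec (f := fun _ => 0) (g := fun a (x : ℕ × ℕ) => x.2 + f a x.1) (Primrec.const 0)
      (Primrec.nat_add.comp (Primrec.snd.comp Primrec.snd)
        (hf.comp Primrec.fst (Primrec.fst.comp Primrec.snd)))
  refine h.of_eq fun a n => ?_
  induction n with
  | zero => simp
  | succ n ih => rw [Finset.sum_range_succ, ← ih]

variable {U : List Bool → List Bool →. List Bool} {ν : ℕ → List Bool → ℝ}

theorem IsPrefixMachine.re_mem_bits (hU : IsPrefixMachine U) :
    REPred fun y : List Bool × ℕ => Nat.bits y.2 ∈ U y.1 [] := by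
  classical
  have h1 : Partrec fun y : List Bool × ℕ => U y.1 [] :=
    Partrec₂.comp hU.partrec Computable.fst (Computable.const [])
  have h2 : REPred fun y : (List Bool × ℕ) × List Bool => y.2 = Nat.bits y.1.2 :=
    (Primrec.eq.comp Primrec.snd (Nat.primrec_bits.comp
      (Primrec.snd.comp Primrec.fst))).computablePred.to_re
  refine (Partrec.dom_re (Partrec.bind h1 (Partrec.to₂ h2))).of_eq fun y => ?_
  simp only [Part.dom_iff_mem, Part.mem_bind_iff, Part.mem_assert_iff]
  constructor
  · rintro ⟨-, a, ha, h, -⟩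
    exact h ▸ ha
  · intro h
    exact ⟨(), _, h, rfl, Part.mem_some _⟩

/-- A finite certificate `(k, D, L)` for a lower bound on `M x`: the entry `(p, a)` at place `i` of
`L` certifies, by computations of at most `k` steps, that `a / (D + 1)` is less than
`2 ^ (-ℓ(p)) * ν i x` with `U(p) = i`. -/
def Certifies (RU : List Bool × ℕ → ℕ → Prop) (RN : (ℕ × List Bool) × ℕ × ℕ → ℕ → Prop)
    (x : List Bool) (k D : ℕ) (L : List (List Bool × ℕ)) : Prop :=
  ∀ i < L.length, (L.getD i default).2 = 0 ∨ RU ((L.getD i default).1, i) k ∧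
    RN ((i, x), (L.getD i default).2 * 2 ^ (L.getD i default).1.length, D) k

theorem primrec_certifies {RU : List Bool × ℕ → ℕ → Prop}
    {RN : (ℕ × List Bool) × ℕ × ℕ → ℕ → Prop} (hRU : PrimrecRel RU) (hRN : PrimrecRel RN) :
    PrimrecPred fun y : List Bool × ℕ × ℕ × List (List Bool × ℕ) =>
      Certifies RU RN y.1 y.2.1 y.2.2.1 y.2.2.2 := by
  let Y := List Bool × ℕ × ℕ × List (List Bool × ℕ)
  have s : Primrec fun z : ℕ × Y => z.2 := Primrec.snd
  have fx : Primrec fun z : ℕ × Y => z.2.1 := Primrec.fst.comp s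
  have fk : Primrec fun z : ℕ × Y => z.2.2.1 := Primrec.fst.comp (Primrec.snd.comp s)
  have fDL : Primrec fun z : ℕ × Y => z.2.2.2 := Primrec.snd.comp (Primrec.snd.comp s)
  have fe : Primrec fun z : ℕ × Y => z.2.2.2.2.getD z.1 default :=
    (Primrec.list_getD default).comp (Primrec.snd.comp fDL) Primrec.fst
  have hR : PrimrecRel fun (i : ℕ) (y : Y) =>
      (y.2.2.2.getD i default).2 = 0 ∨ RU ((y.2.2.2.getD i default).1, i) y.2.1 ∧
        RN ((i, y.1), (y.2.2.2.getD i default).2 * 2 ^ (y.2.2.2.getD i default).1.length,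
          y.2.2.1) y.2.1 := by
    refine PrimrecPred.or (Primrec.eq.comp (Primrec.snd.comp fe) (Primrec.const 0))
      (PrimrecPred.and (hRU.comp ((Primrec.fst.comp fe).pair Primrec.fst) fk)
        (hRN.comp ((Primrec.fst.pair fx).pair (Primrec.pair ?_ (Primrec.fst.comp fDL))) fk))
    exact Primrec.nat_mul.comp (Primrec.snd.comp fe) (Primrec.nat_pow.comp (Primrec.const 2)
      (Primrec.list_length.comp (Primrec.fst.comp fe)))
  have hlt := hR.forall_mem_list
  refine (hlt.comp (f := fun y : Y => List.range y.2.2.2.length) (g := fun y : Y => y)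
    (Primrec.list_range.comp (Primrec.list_length.comp (Primrec.snd.comp (Primrec.snd.comp
      Primrec.snd)))) Primrec.id).of_eq fun y => ?_
  simp only [List.mem_range]
  rfl

/-- Soundness: any program for `i`, shortest or not, has length at least K(i), so each entry
underestimates its term. -/
theorem Certifies.sum_le_M {RU : List Bool × ℕ → ℕ → Prop}
    {RN : (ℕ × List Bool) × ℕ × ℕ → ℕ → Prop} (hU : IsUniversalPrefixMachine U)
    (hν : ∀ i, IsSemimeasure (ν i))
    (hRU : ∀ y k, RU y k → Nat.bits y.2 ∈ U y.1 [])
    (hRN : ∀ q k, RN q k → (q.2.1 : ℝ) / ((q.2.2 : ℝ) + 1) < ν q.1.1 q.1.2)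
    {x : List Bool} {k D : ℕ} {L : List (List Bool × ℕ)} (h : Certifies RU RN x k D L) :
    ((∑ i ∈ Finset.range L.length, (L.getD i default).2 : ℕ) : ℝ) / (D + 1) ≤ M U ν x := by
  rw [Nat.cast_sum, Finset.sum_div]
  refine (Finset.sum_le_sum fun i hi => ?_).trans ((summable_M hU hν x).sum_le_tsum
    (Finset.range L.length) fun i _ => mul_nonneg (by positivity) ((hν i).nonneg x))
  rcases h i (Finset.mem_range.1 hi) with h0 | ⟨h1, h2⟩
  · have h1 : 0 ≤ (2 : ℝ)⁻¹ ^ K U i * ν i x := mul_nonneg (by positivity) ((hν i).nonneg x)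
    exact le_trans (by rw [h0]; simp) h1
  · have h3 := hRN _ _ h2
    have h4 := K_le_length (hRU _ _ h1)
    generalize L.getD i default = e at *
    simp only at h3 h4
    calc (e.2 : ℝ) / (D + 1) = 2⁻¹ ^ e.1.length * (((e.2 * 2 ^ e.1.length : ℕ) : ℝ) / (D + 1)) := by
          push_cast
          rw [inv_pow]
          field_simp
      _ ≤ 2⁻¹ ^ K U i * ν i x := by
          refine mul_le_mul ?_ h3.le (by positivity) (by positivity)
          exact pow_le_pow_of_le_one (by norm_num) (by norm_num) h4

/-- Completeness: truncate the series, use shortest programs, and round each term down to a multiple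
of 1/(D + 1). -/
theorem exists_certifies {RU : List Bool × ℕ → ℕ → Prop}
    {RN : (ℕ × List Bool) × ℕ × ℕ → ℕ → Prop} (hU : IsUniversalPrefixMachine U)
    (hν : ∀ i, IsSemimeasure (ν i))
    (hRUm : ∀ a k k', k ≤ k' → RU a k → RU a k') (hRNm : ∀ a k k', k ≤ k' → RN a k → RN a k')
    (hRU : ∀ y, Nat.bits y.2 ∈ U y.1 [] → ∃ k, RU y k)
    (hRN : ∀ q, (q.2.1 : ℝ) / ((q.2.2 : ℝ) + 1) < ν q.1.1 q.1.2 → ∃ k, RN q k)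
    {x : List Bool} {r : ℝ} (hr : r < M U ν x) :
    ∃ k D L, Certifies RU RN x k D L ∧
      r * (D + 1) < ((∑ i ∈ Finset.range L.length, (L.getD i default).2 : ℕ) : ℝ) := by
  set t : ℕ → ℝ := fun i => (2 : ℝ)⁻¹ ^ K U i * ν i x with ht
  obtain ⟨N, hN⟩ : ∃ N, r < ∑ i ∈ Finset.range N, t i :=
    ((summable_M hU hν x).hasSum.tendsto_sum_nat.eventually (lt_mem_nhds hr)).exists
  choose p hp hpU using hU.exists_program_length_eq
  set s := ∑ i ∈ Finset.range N, t i with hs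
  -- Rounding loses at most 1/(D + 1) per term; this `D` keeps the total loss over `N` terms below s
  -- - r.
  obtain ⟨D, hD⟩ := exists_nat_gt ((N : ℝ) / (s - r))
  -- Ceiling minus one, not floor: certificates need strict inequality. Zero entries need no
  -- certificate, which covers vanishing terms.
  set a : ℕ → ℕ := fun i => ⌈t i * (D + 1)⌉₊ - 1 with ha
  have hai : ∀ i, a i = ⌈t i * ((D : ℝ) + 1)⌉₊ - 1 := fun i => rfl
  have ha1 : ∀ i, t i * (D + 1) - 1 ≤ a i := fun i => by
    have h1 := Nat.le_ceil (t i * ((D : ℝ) + 1))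
    have h2 : ⌈t i * ((D : ℝ) + 1)⌉₊ ≤ a i + 1 := by rw [hai]; omega
    have h3 : ((⌈t i * ((D : ℝ) + 1)⌉₊ : ℕ) : ℝ) ≤ a i + 1 := by exact_mod_cast h2
    linarith
  have ha2 : ∀ i, a i ≠ 0 → (a i : ℝ) < t i * (D + 1) := fun i hi => Nat.lt_ceil.1 (by
    rw [hai] at hi ⊢; omega)
  have hNu : ∀ i, ∃ k, a i = 0 ∨ RN ((i, x), a i * 2 ^ (p i).length, D) k := by
    intro i
    by_cases h0 : a i = 0
    · exact ⟨0, Or.inl h0⟩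
    · obtain ⟨k, hk⟩ := hRN ((i, x), a i * 2 ^ (p i).length, D) (by
        have h1 := ha2 i h0
        have hD1 : (0 : ℝ) < (D : ℝ) + 1 := by positivity
        rw [div_lt_iff₀ hD1]
        push_cast
        simp only [ht, ← hp i, inv_pow] at h1
        have h2 : (0 : ℝ) < 2 ^ (p i).length := by positivity
        calc (a i : ℝ) * 2 ^ (p i).length
            < (((2 : ℝ) ^ (p i).length)⁻¹ * ν i x * (D + 1)) * 2 ^ (p i).length :=
              mul_lt_mul_of_pos_right h1 h2
          _ = ν i x * (D + 1) := by field_simp)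
      exact ⟨k, Or.inr hk⟩
  choose kN hkN using hNu
  choose kU hkU using fun i => hRU (p i, i) (hpU i)
  have hget : ∀ i < N, ((List.range N).map fun i => (p i, a i)).getD i default = (p i, a i) :=
    fun i hi => by simp [List.getD_eq_getElem?_getD, hi]
  refine ⟨∑ i ∈ Finset.range N, (kN i + kU i), D, (List.range N).map fun i => (p i, a i), ?_, ?_⟩
  · intro i hi
    rw [List.length_map, List.length_range] at hi
    have hle : kN i + kU i ≤ ∑ i ∈ Finset.range N, (kN i + kU i) :=
      Finset.single_le_sum (f := fun i => kN i + kU i) (fun _ _ => Nat.zero_le _)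
        (Finset.mem_range.2 hi)
    rw [hget i hi]
    rcases hkN i with h0 | h0
    · exact Or.inl h0
    · exact Or.inr ⟨hRUm _ _ _ (by omega) (hkU i), hRNm _ _ _ (by omega) h0⟩
  · rw [List.length_map, List.length_range, Finset.sum_congr rfl fun i hi => by
      rw [hget i (Finset.mem_range.1 hi)], Nat.cast_sum]
    have h1 : s * (D + 1) - N ≤ ∑ i ∈ Finset.range N, (a i : ℝ) := by
      refine le_trans (le_of_eq ?_) (Finset.sum_le_sum fun i _ => ha1 i)
      simp [Finset.sum_sub_distrib, Finset.sum_mul, hs]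
    rw [div_lt_iff₀ (by linarith)] at hD
    linarith

/-- The prior `M` is enumerable, tested here against powers of two. -/
theorem re_two_inv_pow_lt_M (hU : IsUniversalPrefixMachine U)
    (hν : IsEnumerationOfSemimeasures ν) (B : ℕ) :
    REPred fun y : List Bool × ℕ => (2 : ℝ)⁻¹ ^ (B * y.2) < M U ν y.1 := by
  obtain ⟨RU, hRU, hRUm, hRUe⟩ := hU.isPrefixMachine.re_mem_bits.exists_primrecRel
  obtain ⟨RN, hRN, hRNm, hRNe⟩ := REPred.exists_primrecRel hν.enumerable
  let Y := List Bool × ℕ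
  let W := ℕ × ℕ × List (List Bool × ℕ)
  have f1 : Primrec fun z : Y × W => z.2.2 := Primrec.snd.comp Primrec.snd
  have f2 : Primrec fun z : Y × W => z.2.2.1 := Primrec.fst.comp f1
  have f3 : Primrec fun z : Y × W => z.2.2.2 := Primrec.snd.comp f1
  have f4 : Primrec fun z : Y × W => z.1.2 := Primrec.snd.comp Primrec.fst
  have f5 : Primrec₂ fun (L : List (List Bool × ℕ)) i => (L.getD i default).2 :=
    Primrec.snd.comp ((Primrec.list_getD default).comp Primrec.fst Primrec.snd)
  have hR : PrimrecPred fun z : Y × W => Certifies RU RN z.1.1 z.2.1 z.2.2.1 z.2.2.2 ∧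
      z.2.2.1 + 1 < 2 ^ (B * z.1.2) *
        ∑ i ∈ Finset.range z.2.2.2.length, (z.2.2.2.getD i default).2 := by
    refine PrimrecPred.and ((primrec_certifies hRU hRN).comp
      ((Primrec.fst.comp Primrec.fst).pair Primrec.snd)) ?_
    refine Primrec.nat_lt.comp (Primrec.succ.comp f2) (Primrec.nat_mul.comp
      (Primrec.nat_pow.comp (Primrec.const 2) (Primrec.nat_mul.comp (Primrec.const B) f4)) ?_)
    exact (Primrec.sum_range f5).comp f3 (Primrec.list_length.comp f3)
  -- Clearing denominators turns the test into a decidable comparison of natural numbers.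
  have cast_iff : ∀ (D m S : ℕ), D + 1 < 2 ^ m * S ↔ (2 : ℝ)⁻¹ ^ m * (D + 1) < (S : ℝ) := by
    intro D m S
    rw [inv_pow, inv_mul_lt_iff₀ (by positivity)]
    exact_mod_cast Iff.rfl
  refine (REPred.exists hR.computablePred.to_re).of_eq fun y => ⟨?_, fun h => ?_⟩
  · rintro ⟨⟨k, D, L⟩, h1, h2⟩
    have h3 := h1.sum_le_M hU hν.isSemimeasure (fun y k h => (hRUe y).2 ⟨k, h⟩)
      (fun q k h => (hRNe q).2 ⟨k, h⟩)
    refine lt_of_lt_of_le ?_ h3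
    rw [lt_div_iff₀ (by positivity)]
    exact (cast_iff _ _ _).1 h2
  · obtain ⟨k, D, L, h1, h2⟩ := exists_certifies hU hν.isSemimeasure hRUm hRNm
      (fun y => (hRUe y).1) (fun q => (hRNe q).1) h
    exact ⟨⟨k, D, L⟩, h1, (cast_iff _ _ _).2 h2⟩

end Enumerability

end AIT

namespace AIT

/-! ### Monotonicity of the divergence and existence of its limit -/

section Divergence

variable {μ ρ : List Bool → ℝ}

/-- From ln t ≥ 1 - 1/t, which gives p ln(p/q) ≥ p - q. -/
theorem mul_log_div_ge {p q : ℝ} (hp : 0 < p) (hq : 0 < q) (hq1 : q ≤ 1) :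
    p - 1 ≤ p * Real.log (p / q) := by
  have h := Real.one_sub_inv_le_log_of_pos (div_pos hp hq)
  have h1 := mul_le_mul_of_nonneg_left h hp.le
  have h2 : p * (1 - (p / q)⁻¹) = p - q := by field_simp
  linarith

/-- The log sum inequality for two summands. -/
theorem log_sum_le {p₀ p₁ q₀ q₁ q : ℝ} (hp₀ : 0 < p₀) (hp₁ : 0 < p₁) (hq₀ : 0 < q₀) (hq₁ : 0 < q₁)
    (hq : q₀ + q₁ ≤ q) :
    (p₀ + p₁) * Real.log ((p₀ + p₁) / q) ≤
      p₀ * Real.log (p₀ / q₀) + p₁ * Real.log (p₁ / q₁) := by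
  have hqpos : 0 < q := by linarith
  set p := p₀ + p₁ with hp
  have hppos : 0 < p := by positivity
  -- This is ln t ≥ 1 - 1/t at t = (a/b)/(p/q). The two remainders sum to p - (q₀ + q₁)p/q, which is
  -- nonnegative even when q₀ + q₁ < q.
  have key : ∀ {a b : ℝ}, 0 < a → 0 < b →
      a * Real.log (p / q) + (a - b * (p / q)) ≤ a * Real.log (a / b) := by
    intro a b ha hb
    have h := Real.one_sub_inv_le_log_of_pos (div_pos (div_pos ha hb) (div_pos hppos hqpos))
    rw [Real.log_div (div_pos ha hb).ne' (div_pos hppos hqpos).ne'] at h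
    have h1 := mul_le_mul_of_nonneg_left h ha.le
    have h2 : a * (1 - (a / b / (p / q))⁻¹) = a - b * (p / q) := by field_simp
    linarith
  have h0 := key hp₀ hq₀
  have h1 := key hp₁ hq₁
  have h2 : (q₀ + q₁) * (p / q) ≤ p := by
    rw [mul_div_assoc', div_le_iff₀ hqpos]
    nlinarith
  nlinarith

theorem sum_ofFn_succ (F : List Bool → ℝ) (k : ℕ) :
    ∑ y : Fin (k + 1) → Bool, F (List.ofFn y) =
      ∑ y : Fin k → Bool, ∑ b : Bool, F (List.ofFn y ++ [b]) := by
  rw [Finset.sum_comm, ← Fintype.sum_prod_type']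
  refine (Fintype.sum_equiv (Fin.snocEquiv fun _ : Fin (k + 1) => Bool) _ _ fun z => ?_).symm
  rw [List.ofFn_succ', List.concat_eq_append]
  simp [Fin.snocEquiv]

/-- Appending one bit splits each summand in two, and the log sum inequality applies to each split.
-/
theorem monotone_D (hμ : IsMeasure μ) (hμpos : ∀ x, 0 < μ x) (hρ : IsSemimeasure ρ)
    (hρpos : ∀ x, 0 < ρ x) (l : ℕ) (x : List Bool) : Monotone fun n => D μ ρ l n x := by
  let F : List Bool → ℝ := fun y => cond μ y x * Real.log (cond μ y x / cond ρ y x)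
  have hstep : Monotone fun k => ∑ y : Fin k → Bool, F (List.ofFn y) := by
    refine monotone_nat_of_le_succ fun k => ?_
    rw [sum_ofFn_succ]
    refine Finset.sum_le_sum fun y _ => ?_
    generalize List.ofFn y = y
    have hμa : cond μ y x = cond μ (y ++ [true]) x + cond μ (y ++ [false]) x := by
      rw [cond, cond, cond, ← add_div, ← List.append_assoc, ← List.append_assoc, add_comm,
        hμ.add_eq]
    have hρa : cond ρ (y ++ [true]) x + cond ρ (y ++ [false]) x ≤ cond ρ y x := by
      rw [cond, cond, cond, ← add_div, ← List.append_assoc, ← List.append_assoc, add_comm]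
      exact div_le_div_of_nonneg_right (hρ.add_le _) (hρpos x).le
    have hp : ∀ {σ : List Bool → ℝ}, (∀ x, 0 < σ x) → ∀ z, 0 < cond σ z x :=
      fun h z => div_pos (h _) (h _)
    rw [Fintype.sum_bool]
    simp only [F]
    rw [hμa]
    exact log_sum_le (hp hμpos _) (hp hμpos _) (hp hρpos _) (hp hρpos _) hρa
  exact fun n n' h => hstep (by omega : n + 1 - l ≤ n' + 1 - l)

theorem tendsto_D_DInf (hμ : IsMeasure μ) (hμpos : ∀ x, 0 < μ x) (hρ : IsSemimeasure ρ)
    (hρpos : ∀ x, 0 < ρ x) (l : ℕ) (x : List Bool) :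
    Filter.Tendsto (fun n => ((D μ ρ l n x : ℝ) : EReal)) Filter.atTop
      (nhds (DInf μ ρ l x)) := by
  have hmono : Monotone fun n => ((D μ ρ l n x : ℝ) : EReal) := fun n n' h =>
    EReal.coe_le_coe_iff.2 (monotone_D hμ hμpos hρ hρpos l x h)
  exact tendsto_nhds_limUnder ⟨_, tendsto_atTop_iSup hmono⟩

theorem D_le_DInf (hμ : IsMeasure μ) (hμpos : ∀ x, 0 < μ x) (hρ : IsSemimeasure ρ)
    (hρpos : ∀ x, 0 < ρ x) (l n : ℕ) (x : List Bool) :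
    ((D μ ρ l n x : ℝ) : EReal) ≤ DInf μ ρ l x :=
  Monotone.ge_of_tendsto (f := fun n => ((D μ ρ l n x : ℝ) : EReal))
    (fun _ _ h => EReal.coe_le_coe_iff.2 (monotone_D hμ hμpos hρ hρpos l x h))
    (tendsto_D_DInf hμ hμpos hρ hρpos l x) n

theorem D_self (l : ℕ) (x : List Bool) :
    D μ ρ l l x = ∑ b : Bool, cond μ [b] x * Real.log (cond μ [b] x / cond ρ [b] x) := by
  have h : ∀ k, k = 1 → ∑ y : Fin k → Bool, cond μ (List.ofFn y) x *
      Real.log (cond μ (List.ofFn y) x / cond ρ (List.ofFn y) x) =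
      ∑ b : Bool, cond μ [b] x * Real.log (cond μ [b] x / cond ρ [b] x) := by
    rintro k rfl
    exact (sum_ofFn_succ (fun y => cond μ y x * Real.log (cond μ y x / cond ρ y x)) 0).trans
      (by simp)
  exact h _ (by omega)

end Divergence

/-! ### The computable sequence and the mass that leaves it -/

section Sequence

/-- The prefixes of the sequence each of whose bits is computed by `h` from the bits before it. -/
def selfPrefix (h : List Bool → Bool) (n : ℕ) : List Bool :=
  Nat.rec [] (fun _ w => w ++ [h w]) n

variable {h : List Bool → Bool}

theorem selfPrefix_succ (n : ℕ) : selfPrefix h (n + 1) = selfPrefix h n ++ [h (selfPrefix h n)] :=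
  rfl

theorem length_selfPrefix (n : ℕ) : (selfPrefix h n).length = n := by
  induction n with
  | zero => rfl
  | succ n ih => simp [selfPrefix_succ, ih]

theorem computable_selfPrefix (hh : Computable h) : Computable (selfPrefix h) := by
  refine Computable.nat_rec (f := fun n : ℕ => n) (g := fun _ => ([] : List Bool))
    (h := fun _ x => x.2 ++ [h x.2]) Computable.id (Computable.const []) ?_
  have hs : Computable fun x : ℕ × ℕ × List Bool => x.2.2 := Computable.snd.comp Computable.snd
  exact Computable.list_concat.comp hs (hh.comp hs)

theorem before_eq_selfPrefix (l : ℕ) :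
    before (fun n => h (selfPrefix h n)) l = selfPrefix h (l - 1) := by
  rw [before]
  induction l - 1 with
  | zero => rfl
  | succ n ih => rw [List.range_succ, List.map_append, ih, selfPrefix_succ]; rfl

/-- The measure concentrated on the sequence generated by `h`. -/
noncomputable def pointMass (h : List Bool → Bool) (x : List Bool) : ℝ :=
  open Classical in if x = selfPrefix h x.length then 1 else 0

theorem pointMass_selfPrefix (n : ℕ) : pointMass h (selfPrefix h n) = 1 := by
  rw [pointMass, length_selfPrefix, if_pos rfl]

theorem isSemimeasure_pointMass : IsSemimeasure (pointMass h) where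
  nonneg x := by rw [pointMass]; split_ifs <;> norm_num
  nil_le := by rw [pointMass]; split_ifs <;> norm_num
  add_le x := by
    have key : ∀ b, x ++ [b] = selfPrefix h (x ++ [b]).length ↔
        x = selfPrefix h x.length ∧ b = h (selfPrefix h x.length) := by
      intro b
      rw [List.length_append, List.length_singleton, selfPrefix_succ]
      refine ⟨fun e => ?_, fun ⟨e₁, e₂⟩ => by rw [e₂, ← e₁]⟩
      obtain ⟨e₁, e₂⟩ := List.append_inj' e rfl
      exact ⟨e₁, List.singleton_inj.1 e₂⟩
    simp only [pointMass, key]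
    by_cases hx : x = selfPrefix h x.length
    · cases hb : h (selfPrefix h x.length) <;> simp [← hx]
    · simp [hx]

theorem enumerable_pointMass (hh : Computable h) : Enumerable (pointMass h) := by
  have h1 : REPred fun q : List Bool × ℕ × ℕ => q.1 = selfPrefix h q.1.length :=
    REPred.comp (p := fun y : List Bool × List Bool => y.1 = y.2)
      (Primrec.eq (α := List Bool)).computablePred.to_re
      (Computable.fst.pair ((computable_selfPrefix hh).comp
        (Computable.list_length.comp Computable.fst)))
  have h2 : REPred fun q : List Bool × ℕ × ℕ => q.2.1 < q.2.2 + 1 :=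
    (Primrec.nat_lt.comp (Primrec.fst.comp Primrec.snd)
      (Primrec.succ.comp (Primrec.snd.comp Primrec.snd))).computablePred.to_re
  refine (h1.and h2).of_eq fun q => ?_
  rw [pointMass]
  split_ifs with hq
  · rw [div_lt_one (by positivity)]
    exact ⟨fun h => by exact_mod_cast h.2, fun h => ⟨hq, by exact_mod_cast h⟩⟩
  · exact ⟨fun h => absurd h.1 hq, fun h => absurd h (not_lt.2 (by positivity))⟩

theorem exists_nat_div_btwn {a b : ℝ} (ha : 0 ≤ a) (hab : a < b) :
    ∃ k n : ℕ, a < (k : ℝ) / (n + 1) ∧ (k : ℝ) / (n + 1) < b := by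
  obtain ⟨q, hq1, hq2⟩ := exists_rat_btwn hab
  have hq0 : 0 ≤ q := by exact_mod_cast (ha.trans hq1.le)
  have e : ((q.num.toNat : ℕ) : ℝ) / ((q.den - 1 : ℕ) + 1) = (q : ℝ) := by
    have h1 : ((q.den - 1 : ℕ) : ℝ) + 1 = q.den := by
      exact_mod_cast Nat.sub_add_cancel q.den_pos
    have h2 : ((q.num.toNat : ℕ) : ℝ) = (q.num : ℝ) := by
      exact_mod_cast Int.toNat_of_nonneg (Rat.num_nonneg.2 hq0)
    rw [h1, h2, Rat.cast_def]
  exact ⟨_, _, e ▸ hq1, e ▸ hq2⟩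

/-- For a positive computable measure one can compute, after any string, a bit whose complement
has conditional probability greater than `49 / 100`. -/
theorem IsComputableMeasure.exists_computable_bit {μ : List Bool → ℝ} (hμ : IsComputableMeasure μ)
    (hpos : ∀ x, 0 < μ x) :
    ∃ h : List Bool → Bool, Computable h ∧ ∀ x, 49 / 100 * μ x < μ (x ++ [!h x]) := by
  let Y := List Bool × Bool × ℕ × ℕ
  have fb : Computable fun y : Y => y.2.1 := Computable.fst.comp Computable.snd
  have fk : Computable fun y : Y => y.2.2.1 :=
    Computable.fst.comp (Computable.snd.comp Computable.snd)
  have fn : Computable fun y : Y => y.2.2.2 :=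
    Computable.snd.comp (Computable.snd.comp Computable.snd)
  have h1 : REPred fun y : Y => (y.2.2.1 : ℝ) / ((y.2.2.2 : ℝ) + 1) < μ (y.1 ++ [!y.2.1]) :=
    REPred.comp hμ.enumerable (f := fun y : Y => (y.1 ++ [!y.2.1], y.2.2.1, y.2.2.2))
      ((Computable.list_concat.comp Computable.fst (Primrec.not.to_comp.comp fb)).pair
        (fk.pair fn))
  -- The number 48 makes the denominator 49n + 49, so the bound is 100/49 times k/(n + 1).
  have h2 : REPred fun y : Y =>
      μ y.1 < ((100 * y.2.2.1 : ℕ) : ℝ) / (((49 * y.2.2.2 + 48 : ℕ) : ℝ) + 1) :=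
    REPred.comp hμ.coEnumerable (f := fun y : Y => (y.1, 100 * y.2.2.1, 49 * y.2.2.2 + 48))
      (Computable.fst.pair
        (((Primrec.nat_mul.comp (Primrec.const 100) Primrec.id).to_comp.comp fk).pair
          ((Primrec.nat_add.comp (Primrec.nat_mul.comp (Primrec.const 49) Primrec.id)
            (Primrec.const 48)).to_comp.comp fn)))
  have cast_eq : ∀ k n : ℕ, ((100 * k : ℕ) : ℝ) / (((49 * n + 48 : ℕ) : ℝ) + 1) =
      100 / 49 * ((k : ℝ) / (n + 1)) := by
    intro k n
    have e : ((49 * n + 48 : ℕ) : ℝ) + 1 = 49 * (n + 1) := by push_cast; ring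
    rw [e]
    push_cast
    field_simp
  obtain ⟨f, hf, hfp⟩ := (h1.and h2).exists_computable_choice fun x => by
    obtain ⟨b, hb⟩ : ∃ b, 49 / 100 * μ x < μ (x ++ [!b]) := by
      have := hμ.isMeasure.add_eq x
      have := hpos x
      by_contra hcon
      push Not at hcon
      have := hcon true
      have := hcon false
      simp only [Bool.not_true, Bool.not_false] at *
      linarith
    obtain ⟨k, n, hk1, hk2⟩ := exists_nat_div_btwn (by have := hpos x; positivity) hb
    refine ⟨(b, k, n), hk2, ?_⟩
    rw [cast_eq]
    linarith
  refine ⟨fun x => (f x).1, Computable.fst.comp hf, fun x => ?_⟩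
  obtain ⟨h3, h4⟩ := hfp x
  rw [cast_eq] at h4
  simp only at h3 h4
  linarith

/-- The mass branching off before time N, plus the mass still on the path at N, never exceeds the
initial mass. -/
theorem IsSemimeasure.sum_selfPrefix_le_one {ρ : List Bool → ℝ} (hρ : IsSemimeasure ρ)
    (F : Finset ℕ) : ∑ j ∈ F, ρ (selfPrefix h j ++ [!h (selfPrefix h j)]) ≤ 1 := by
  have key : ∀ N, ∑ j ∈ Finset.range N, ρ (selfPrefix h j ++ [!h (selfPrefix h j)]) +
      ρ (selfPrefix h N) ≤ 1 := by
    intro N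
    induction N with
    | zero => simpa [selfPrefix] using hρ.nil_le
    | succ N ih =>
      rw [Finset.sum_range_succ, selfPrefix_succ]
      have := hρ.add_not_le (selfPrefix h N) (h (selfPrefix h N))
      linarith
  obtain ⟨N, hN⟩ := F.exists_nat_subset_range
  have := key N
  have := hρ.nonneg (selfPrefix h N)
  have := Finset.sum_le_sum_of_subset_of_nonneg hN
    (f := fun j => ρ (selfPrefix h j ++ [!h (selfPrefix h j)])) fun j _ _ => hρ.nonneg _
  linarith

end Sequence

end AIT

/-! ### From M-mass off the sequence to complexity of the time -/

namespace AIT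

variable {U : List Bool → List Bool →. List Bool} {ν : ℕ → List Bool → ℝ} {h : List Bool → Bool}

/-- The prior probability of leaving a computable sequence at time `l` bounds the complexity of
`l`, up to a factor `101 / 100`. -/
theorem exists_K_le_of_lt_M (hU : IsUniversalPrefixMachine U)
    (hν : IsEnumerationOfSemimeasures ν) (hh : Computable h) :
    ∃ c : ℕ, ∀ m l, 1 ≤ l →
      (2 : ℝ)⁻¹ ^ (100 * m) < M U ν (selfPrefix h (l - 1) ++ [!h (selfPrefix h (l - 1))]) →
      K U l ≤ 101 * m + c := by
  have hM := isSemimeasure_M hU hν.isSemimeasure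
  have hS1 : REPred fun x : ℕ × ℕ => 1 ≤ x.2 :=
    (Primrec.nat_le.comp (Primrec.const 1) Primrec.snd).computablePred.to_re
  have hpre : Computable fun x : ℕ × ℕ => selfPrefix h (x.2 - 1) :=
    (computable_selfPrefix hh).comp (Computable.pred.comp Computable.snd)
  have hS2 := (re_two_inv_pow_lt_M hU hν 100).comp
    (f := fun x : ℕ × ℕ => (selfPrefix h (x.2 - 1) ++ [!h (selfPrefix h (x.2 - 1))], x.1))
    ((Computable.list_concat.comp hpre (Primrec.not.to_comp.comp (hh.comp hpre))).pair
      Computable.fst)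
  -- Each listed time carries mass above 2^(-100m) out of a total of at most 1. The shift l - 1 is
  -- injective because l ≥ 1.
  obtain ⟨c, hc⟩ := hU.exists_program 100 (hS1.and hS2) fun m F hF => by
    have hinj : Set.InjOn (fun l => l - 1) (F : Set ℕ) := by
      intro a ha b hb hab
      have := (hF a ha).1
      have := (hF b hb).1
      simp only at *
      omega
    have h1 := hM.sum_selfPrefix_le_one (h := h) (F.image fun l => l - 1)
    rw [Finset.sum_image hinj] at h1
    have h2 := (Finset.card_nsmul_le_sum F _ ((2 : ℝ)⁻¹ ^ (100 * m)) fun l hl =>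
      (hF l hl).2.le).trans h1
    rw [nsmul_eq_mul, inv_pow, ← div_eq_mul_inv, div_le_one (by positivity)] at h2
    exact_mod_cast h2
  refine ⟨c, fun m l hl hm => ?_⟩
  obtain ⟨p, hp, hpU⟩ := hc m l ⟨hl, hm⟩
  exact (K_le_length hpU).trans hp

theorem exists_K_le_log_M (hU : IsUniversalPrefixMachine U)
    (hν : IsEnumerationOfSemimeasures ν) (hh : Computable h) (hMpos : ∀ x, 0 < M U ν x) :
    ∃ c : ℝ, ∀ l, 1 ≤ l → 100 * Real.log 2 * K U l ≤
      -101 * Real.log (M U ν (selfPrefix h (l - 1) ++ [!h (selfPrefix h (l - 1))])) + c := by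
  classical
  obtain ⟨c, hc⟩ := exists_K_le_of_lt_M hU hν hh
  refine ⟨100 * Real.log 2 * (101 + c), fun l hl => ?_⟩
  set v := M U ν (selfPrefix h (l - 1) ++ [!h (selfPrefix h (l - 1))]) with hv
  have hv0 : 0 < v := hMpos _
  have hv1 : v ≤ 1 := (isSemimeasure_M hU hν.isSemimeasure).le_one _
  have hex : ∃ m : ℕ, (2 : ℝ)⁻¹ ^ (100 * m) < v := by
    obtain ⟨n, hn⟩ := exists_pow_lt_of_lt_one hv0 (by norm_num : (2 : ℝ)⁻¹ < 1)
    exact ⟨n, (pow_le_pow_of_le_one (by norm_num) (by norm_num) (by omega)).trans_lt hn⟩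
  have hlog2 : 0 < Real.log 2 := Real.log_pos one_lt_two
  -- The least exponent is positive since v ≤ 1; its predecessor fails the test, which bounds v
  -- above by 2^(-100m).
  obtain ⟨m, hm⟩ : ∃ m, Nat.find hex = m + 1 := by
    refine Nat.exists_eq_succ_of_ne_zero fun h0 => ?_
    have := Nat.find_spec hex
    rw [h0] at this
    simp only [mul_zero, pow_zero] at this
    linarith
  have hK := hc (m + 1) l hl (hm ▸ Nat.find_spec hex)
  have hvm : v ≤ (2 : ℝ)⁻¹ ^ (100 * m) := not_lt.1 (Nat.find_min hex (by omega))
  have hlog := Real.log_le_log hv0 hvm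
  rw [Real.log_pow, Real.log_inv] at hlog
  push_cast at hlog
  have hK' : (K U l : ℝ) ≤ 101 * (m + 1) + c := by exact_mod_cast hK
  nlinarith

end AIT

theorem lemma4
    (U : List Bool → List Bool →. List Bool) (hU : AIT.IsUniversalPrefixMachine U)
    (ν : ℕ → List Bool → ℝ) (hν : AIT.IsEnumerationOfSemimeasures ν)
    (μ : List Bool → ℝ) (hμ : AIT.IsComputableMeasure μ) (hpos : ∀ x, 0 < μ x) :
    ∃ α : ℕ → Bool, Computable α ∧ ∃ C : ℝ, ∀ l : ℕ, 1 ≤ l →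
      Filter.Tendsto (fun n => ((AIT.D μ (AIT.M U ν) l n (AIT.before α l) : ℝ) : EReal))
        Filter.atTop (nhds (AIT.DInf μ (AIT.M U ν) l (AIT.before α l))) ∧
      ((AIT.D μ (AIT.M U ν) l l (AIT.before α l) : ℝ) : EReal) ≤
        AIT.DInf μ (AIT.M U ν) l (AIT.before α l) ∧
      AIT.D μ (AIT.M U ν) l l (AIT.before α l) =
        ∑ b : Bool, AIT.cond μ [b] (AIT.before α l) *
          Real.log (AIT.cond μ [b] (AIT.before α l) /
            AIT.cond (AIT.M U ν) [b] (AIT.before α l)) ∧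
      (1 / 3 : ℝ) * (AIT.K U l : ℝ) - C ≤ AIT.D μ (AIT.M U ν) l l (AIT.before α l) := by
  obtain ⟨h, hh, hbit⟩ := hμ.exists_computable_bit hpos
  have hM := AIT.isSemimeasure_M hU hν.isSemimeasure
  have hMpos : ∀ x, 0 < AIT.M U ν x := by
    obtain ⟨c, hc, hcM⟩ := AIT.exists_pos_mul_le_M hU hν hμ.isMeasure.isSemimeasure hμ.enumerable
    exact fun x => (mul_pos hc (hpos x)).trans_le (hcM x)
  obtain ⟨c₁, hc₁, hc₁M⟩ := AIT.exists_pos_mul_le_M hU hν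
    (AIT.isSemimeasure_pointMass (h := h)) (AIT.enumerable_pointMass hh)
  obtain ⟨c₂, hc₂⟩ := AIT.exists_K_le_log_M hU hν hh hMpos
  refine ⟨fun n => h (AIT.selfPrefix h n), hh.comp (AIT.computable_selfPrefix hh),
    1 + (49 / 10100 * |c₂| - 49 / 100 * Real.log c₁), fun l hl => ?_⟩
  rw [AIT.before_eq_selfPrefix]
  set x := AIT.selfPrefix h (l - 1) with hx
  refine ⟨AIT.tendsto_D_DInf hμ.isMeasure hpos hM hMpos l x,
    AIT.D_le_DInf hμ.isMeasure hpos hM hMpos l l x, AIT.D_self l x, ?_⟩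
  have hK := hc₂ l hl
  rw [← hx] at hK
  have hMx : c₁ ≤ AIT.M U ν x := by
    have := hc₁M x
    rwa [hx, AIT.pointMass_selfPrefix, mul_one, ← hx] at this
  have hD : AIT.D μ (AIT.M U ν) l l x =
      AIT.cond μ [h x] x * Real.log (AIT.cond μ [h x] x / AIT.cond (AIT.M U ν) [h x] x) +
      AIT.cond μ [!h x] x * Real.log (AIT.cond μ [!h x] x / AIT.cond (AIT.M U ν) [!h x] x) := by
    rw [AIT.D_self, Fintype.sum_bool]
    cases h x <;> simp [add_comm]
  rw [hD]
  have hcpos : ∀ {σ : List Bool → ℝ}, (∀ x, 0 < σ x) → ∀ b, 0 < AIT.cond σ [b] x :=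
    fun h b => div_pos (h _) (h _)
  have hsum : AIT.cond μ [h x] x + AIT.cond μ [!h x] x = 1 := by
    rw [AIT.cond, AIT.cond, ← add_div, hμ.isMeasure.add_not_eq, div_self (hpos x).ne']
  have hp : 49 / 100 < AIT.cond μ [!h x] x := by
    rw [AIT.cond, lt_div_iff₀ (hpos x)]
    exact hbit x
  have hq1 : ∀ b, AIT.cond (AIT.M U ν) [b] x ≤ 1 := fun b =>
    (div_le_one (hMpos x)).2 (hM.append_le x b)
  -- The term of the bit taken, and p ln p for the other bit, are at least their probabilities minus
  -- 1; together at least -1.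
  have h1 := AIT.mul_log_div_ge (hcpos hpos (h x)) (hcpos hMpos (h x)) (hq1 _)
  have h2 := AIT.mul_log_div_ge (hcpos hpos (!h x)) one_pos le_rfl
  rw [div_one] at h2
  have hlogq : Real.log (AIT.cond (AIT.M U ν) [!h x] x) ≤
      Real.log (AIT.M U ν (x ++ [!h x])) - Real.log c₁ := by
    rw [AIT.cond, Real.log_div (hMpos _).ne' (hMpos _).ne']
    have := Real.log_le_log hc₁ hMx
    linarith
  have hlogq0 : Real.log (AIT.cond (AIT.M U ν) [!h x] x) ≤ 0 :=
    Real.log_nonpos (hcpos hMpos _).le (hq1 _)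
  rw [Real.log_div (hcpos hpos (!h x)).ne' (hcpos hMpos (!h x)).ne']
  have hlog2 := Real.log_two_gt_d9
  have hK0 : (0 : ℝ) ≤ AIT.K U l := Nat.cast_nonneg _
  -- The bound ln 2 > 0.69 suffices: (49/100)(69/101) > 1/3.
  have h3 : 69 * (AIT.K U l : ℝ) ≤ 100 * Real.log 2 * AIT.K U l :=
    mul_le_mul_of_nonneg_right (by linarith) hK0
  have h4 := le_abs_self c₂
  have h5 : 49 / 100 * -Real.log (AIT.cond (AIT.M U ν) [!h x] x) ≤
      AIT.cond μ [!h x] x * -Real.log (AIT.cond (AIT.M U ν) [!h x] x) :=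
    mul_le_mul_of_nonneg_right hp.le (by linarith)
  linarith
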